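/- Let $N,n$ be natural numbers and $\lambda=(\lambda_1,\dots,\lambda_N)\in\mathbb Z_{\ge0}^N$ with $\lambda_1+\dots+\lambda_N=n$. Let $\mathcal I_\lambda$ be the set of all ordered partitions $I=(I_1,\dots,I_N)$ of $\{1,\dots,n\}$ into disjoint (possibly empty) subsets with $|I_k|=\lambda_k$. Put $\lambda^{(j)}=\lambda_1+\dots+\lambda_j$ and write $I_1\cup\dots\cup I_j=\{i^{(j)}_1<\dots<i^{(j)}_{\lambda^{(j)}}\}$. Consider variables $h$, $\boldsymbol z=(z_1,\dots,z_n)$ and $\boldsymbol t=(t^{(j)}_a)$, $1\le j\le N-1$, $1\le a\le\lambda^{(j)}$, and set $t^{(N)}_a=z_a$. For $I\in\mathcal I_\lambda$ let $$U_I(\boldsymbol t;\boldsymbol z;h)=\prod_{j=1}^{N-1}\prod_{a=1}^{\lambda^{(j)}}\Bigl(\prod_{c:\ i^{(j+1)}_c<i^{(j)}_a}(t^{(j)}_a-t^{(j+1)}_c-h)\prod_{d:\ i^{(j+1)}_d>i^{(j)}_a}(t^{(j)}_a-t^{(j+1)}_d)\prod_{b=a+1}^{\lambda^{(j)}}\frac{t^{(j)}_a-t^{(j)}_b-h}{t^{(j)}_a-t^{(j)}_b}\Bigr),$$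 $$W_I(\boldsymbol t;\boldsymbol z;h)=(-h)^{\lambda^{(1)}+\dots+\lambda^{(N-1)}}\ \mathrm{Sym}_{t^{(1)}}\cdots\mathrm{Sym}_{t^{(N-1)}}\,U_I(\boldsymbol t;\boldsymbol z;h),$$ where $\mathrm{Sym}_{t^{(j)}}$ is the sum over all permutations of the variables $t^{(j)}_1,\dots,t^{(j)}_{\lambda^{(j)}}$ (without normalization). For $\sigma\in S_n$ let $$W_{\sigma,I}(\boldsymbol t;\boldsymbol z;h)=W_{\sigma^{-1}(I)}(\boldsymbol t;z_{\sigma(1)},\dots,z_{\sigma(n)};h),\qquad \sigma^{-1}(I)=(\sigma^{-1}(I_1),\dots,\sigma^{-1}(I_N)).$$ For $I\in\mathcal I_\lambda$ and $f(\boldsymbol t;\boldsymbol z;h)$ symmetric in each group $t^{(1)},\dots,t^{(N-1)}$, let $f(\boldsymbol z_I;\boldsymbol z;h)$ be obtained by replacing, for each $j\le N-1$, the variables $t^{(j)}$ with $\{z_i: i\in I_1\cup\dots\cup I_j\}$. Put $$R(\boldsymbol z_I)=\prod_{a<b}\prod_{i\in I_a}\prod_{j\in I_b}(z_i-z_j),\qquad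 Q(\boldsymbol z_I)=\prod_{a<b}\prod_{i\in I_a}\prod_{j\in I_b}(z_i-z_j-h),$$ $$c_\lambda(\boldsymbol z_I)=\prod_{a=1}^{N-1}\ \prod_{i,j\in I_1\cup\dots\cup I_a}(z_i-z_j-h)$$ (the factors with $i=j$ are included). Let $\mathrm{id}\in S_n$ be the identity and $\sigma_0\in S_n$ the longest permutation, $\sigma_0(i)=n+1-i$. Then for all $J,K\in\mathcal I_\lambda$, in the field $\mathbb C(\boldsymbol z;h)$, $$\sum_{I\in\mathcal I_\lambda}\frac{W_{\mathrm{id},J}(\boldsymbol z_I;\boldsymbol z;h)\,W_{\sigma_0,K}(\boldsymbol z_I;\boldsymbol z;h)}{R(\boldsymbol z_I)\,Q(\boldsymbol z_I)\,c_\lambda(\boldsymbol z_I)^2}=\delta_{J,K}.$$ -/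

import Mathlib

noncomputable section

namespace WeightFn

open Finset

/-- The set `𝓘_λ` of ordered partitions `I = (I_1, …, I_N)` of an `n`-element set into (possibly
empty) blocks with `|I_k| = λ_k`. A partition is encoded by the map that sends a point to the index
of its block: `I_k = {a | I a = k}`. All indices in `Fin N`, `Fin n` are shifted by one. -/
abbrev Partitions {N : ℕ} (n : ℕ) (lam : Fin N → ℕ) : Type :=
  {I : Fin n → Fin N // ∀ k, #{a | I a = k} = lam k}

/-- `λ^{(j)} = λ_1 + ⋯ + λ_j`. -/
def partialSum {N : ℕ} (lam : Fin N → ℕ) (j : ℕ) : ℕ := ∑ k with k.val < j, lam k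

variable {N n : ℕ} {lam : Fin N → ℕ}

/-- The block `I_k`. -/
def block (I : Partitions n lam) (k : Fin N) : Finset (Fin n) := {a | I.1 a = k}

/-- The union `I_1 ∪ ⋯ ∪ I_j`. -/
def blockUnion (I : Partitions n lam) (j : ℕ) : Finset (Fin n) := {a | (I.1 a).val < j}

theorem card_blockUnion (I : Partitions n lam) (j : ℕ) :
    #(blockUnion I j) = partialSum lam j := by
  unfold partialSum blockUnion
  rw [Finset.card_eq_sum_card_fiberwise (f := I.1) (t := ({k | k.val < j} : Finset (Fin N)))
    (by intro a; simp)]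
  refine Finset.sum_congr rfl fun k hk => ?_
  rw [← I.2 k, Finset.filter_filter]
  congr 1
  ext a
  simp only [Finset.mem_filter, Finset.mem_univ, true_and] at hk ⊢
  constructor
  · exact fun h => h.2
  · exact fun h => ⟨h ▸ hk, h⟩

theorem partialSum_le (I : Partitions n lam) (j : ℕ) : partialSum lam j ≤ n := by
  rw [← card_blockUnion I j]
  simpa using Finset.card_le_univ (blockUnion I j)

/-- The increasing enumeration `i^{(j)}_1 < ⋯ < i^{(j)}_{λ^{(j)}}` of `I_1 ∪ ⋯ ∪ I_j`. -/
def enum (I : Partitions n lam) (j : ℕ) : Fin (partialSum lam j) ↪o Fin n :=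
  (blockUnion I j).orderEmbOfFin (card_blockUnion I j)

/-- `σ⁻¹(I) = (σ⁻¹(I_1), …, σ⁻¹(I_N))`. -/
def permInv (σ : Equiv.Perm (Fin n)) (I : Partitions n lam) : Partitions n lam :=
  ⟨I.1 ∘ σ, fun k => by
    rw [← I.2 k]
    exact Finset.card_bij (fun a _ => σ a) (by simp) (by simp)
      (fun b hb => ⟨σ.symm b, by simpa using hb, by simp⟩)⟩

/-- All levels of variables `t^{(j)}_a`: those with `1 ≤ j ≤ N - 1` are given by `t`, and
`t^{(N)}_a = z_a`. (Only the levels `1 ≤ j ≤ N` are ever used.) -/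
def levels {F : Type*} (I : Partitions n lam)
    (t : ∀ j : {j // j ∈ Ico 1 N}, Fin (partialSum lam j) → F) (z : Fin n → F)
    (j : ℕ) (a : Fin (partialSum lam j)) : F :=
  if hj : j ∈ Ico 1 N then t ⟨j, hj⟩ a else z (Fin.castLE (partialSum_le I j) a)

/-- The expression `U_I(t; z; h)`, for elements `t^{(j)}_a`, `h` of a field. -/
def U {F : Type*} [Field F] (I : Partitions n lam)
    (t : ∀ j : ℕ, Fin (partialSum lam j) → F) (h : F) : F :=
  ∏ j ∈ Ico 1 N, ∏ a : Fin (partialSum lam j),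
    ((∏ c with enum I (j + 1) c < enum I j a, (t j a - t (j + 1) c - h)) *
      (∏ d with enum I j a < enum I (j + 1) d, (t j a - t (j + 1) d)) *
      ∏ b with a < b, (t j a - t j b - h) / (t j a - t j b))

/-- The expression `W_I(t; z; h) = (-h)^{λ^{(1)} + ⋯ + λ^{(N-1)}} Sym_{t^{(1)}} ⋯ Sym_{t^{(N-1)}} U_I`,
for elements `t^{(j)}_a`, `z_a`, `h` of a field. -/
def W {F : Type*} [Field F] (I : Partitions n lam)
    (t : ∀ j : {j // j ∈ Ico 1 N}, Fin (partialSum lam j) → F) (z : Fin n → F) (h : F) : F :=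
  (-h) ^ (∑ j ∈ Ico 1 N, partialSum lam j) *
    ∑ τ : (∀ j : {j // j ∈ Ico 1 N}, Equiv.Perm (Fin (partialSum lam j))),
      U I (levels I (fun j a => t j (τ j a)) z) h

/-- Names of the variables `z_1, …, z_n, h`. -/
inductive ZHVar (n : ℕ) : Type
  | z (a : Fin n) : ZHVar n
  | h : ZHVar n

/-- Names of the variables `t^{(j)}_a` (`1 ≤ j ≤ N - 1`, `1 ≤ a ≤ λ^{(j)}`), `z_1, …, z_n`, `h`. -/
inductive TZHVar {N : ℕ} (n : ℕ) (lam : Fin N → ℕ) : Type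
  | t (j : {j // j ∈ Ico 1 N}) (a : Fin (partialSum lam j)) : TZHVar n lam
  | z (a : Fin n) : TZHVar n lam
  | h : TZHVar n lam

/-- The field `ℂ(z_1, …, z_n; h)`. -/
def RatZH (n : ℕ) : Type := FractionRing (MvPolynomial (ZHVar n) ℂ)

instance (n : ℕ) : Field (RatZH n) :=
  inferInstanceAs (Field (FractionRing (MvPolynomial (ZHVar n) ℂ)))

instance (n : ℕ) : Algebra ℂ (RatZH n) :=
  inferInstanceAs (Algebra ℂ (FractionRing (MvPolynomial (ZHVar n) ℂ)))

instance (n : ℕ) : Algebra (MvPolynomial (ZHVar n) ℂ) (RatZH n) :=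
  inferInstanceAs (Algebra (MvPolynomial (ZHVar n) ℂ) (FractionRing (MvPolynomial (ZHVar n) ℂ)))

instance (n : ℕ) : IsScalarTower ℂ (MvPolynomial (ZHVar n) ℂ) (RatZH n) :=
  inferInstanceAs
    (IsScalarTower ℂ (MvPolynomial (ZHVar n) ℂ) (FractionRing (MvPolynomial (ZHVar n) ℂ)))

instance (n : ℕ) : IsFractionRing (MvPolynomial (ZHVar n) ℂ) (RatZH n) :=
  inferInstanceAs
    (IsFractionRing (MvPolynomial (ZHVar n) ℂ) (FractionRing (MvPolynomial (ZHVar n) ℂ)))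

/-- The variable `z_a` as an element of `ℂ(z; h)`. -/
def zvar (a : Fin n) : RatZH n := algebraMap (MvPolynomial _ ℂ) _ (MvPolynomial.X (R := ℂ) (ZHVar.z a))

/-- The variable `h` as an element of `ℂ(z; h)`. -/
def hvar : RatZH n := algebraMap (MvPolynomial _ ℂ) _ (MvPolynomial.X (R := ℂ) (ZHVar.h (n := n)))

/-- The field `ℂ(t; z; h)`. -/
def RatTZH {N : ℕ} (n : ℕ) (lam : Fin N → ℕ) : Type :=
  FractionRing (MvPolynomial (TZHVar n lam) ℂ)

instance : Field (RatTZH n lam) :=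
  inferInstanceAs (Field (FractionRing (MvPolynomial (TZHVar n lam) ℂ)))

instance : Algebra (MvPolynomial (TZHVar n lam) ℂ) (RatTZH n lam) :=
  inferInstanceAs
    (Algebra (MvPolynomial (TZHVar n lam) ℂ) (FractionRing (MvPolynomial (TZHVar n lam) ℂ)))

instance : IsFractionRing (MvPolynomial (TZHVar n lam) ℂ) (RatTZH n lam) :=
  inferInstanceAs
    (IsFractionRing (MvPolynomial (TZHVar n lam) ℂ) (FractionRing (MvPolynomial (TZHVar n lam) ℂ)))

/-- A variable as an element of `ℂ(t; z; h)`. -/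
def var (v : TZHVar n lam) : RatTZH n lam := algebraMap (MvPolynomial _ ℂ) _ (MvPolynomial.X (R := ℂ) v)

/-- The weight function
`W_{σ,I}(t; z; h) = W_{σ⁻¹(I)}(t; z_{σ(1)}, …, z_{σ(n)}; h)`, as an element of `ℂ(t; z; h)`. -/
def weightFunction (σ : Equiv.Perm (Fin n)) (I : Partitions n lam) : RatTZH n lam :=
  W (permInv σ I) (fun j a => var (TZHVar.t j a)) (fun a => var (TZHVar.z (σ a))) (var TZHVar.h)

/-- The substitution `t^{(j)} = (z_i)_{i ∈ I_1 ∪ ⋯ ∪ I_j}`, `1 ≤ j ≤ N - 1`, on polynomials. -/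
def substHom (I : Partitions n lam) : MvPolynomial (TZHVar n lam) ℂ →ₐ[ℂ] RatZH n :=
  MvPolynomial.aeval fun v => match v with
    | TZHVar.t j a => zvar (enum I j a)
    | TZHVar.z a => zvar a
    | TZHVar.h => hvar

/-- `f(z_I; z; h)`: the substitution `t^{(j)} = (z_i)_{i ∈ I_1 ∪ ⋯ ∪ I_j}` in a rational
function, written in lowest terms, whose denominator does not vanish under the substitution
(for a polynomial `f` the denominator is a constant). -/
def subst (I : Partitions n lam) (f : RatTZH n lam) : RatZH n :=
  substHom I (IsFractionRing.num (MvPolynomial (TZHVar n lam) ℂ) f) /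
    substHom I (IsFractionRing.den (MvPolynomial (TZHVar n lam) ℂ) f : MvPolynomial _ ℂ)

/-- `R(z_I) = ∏_{a < b} ∏_{i ∈ I_a} ∏_{j ∈ I_b} (z_i - z_j)`. -/
def R (I : Partitions n lam) : RatZH n :=
  ∏ a : Fin N, ∏ b with a < b, ∏ i ∈ block I a, ∏ j ∈ block I b, (zvar i - zvar j)

/-- `Q(z_I) = ∏_{a < b} ∏_{i ∈ I_a} ∏_{j ∈ I_b} (z_i - z_j - h)`. -/
def Q (I : Partitions n lam) : RatZH n :=
  ∏ a : Fin N, ∏ b with a < b, ∏ i ∈ block I a, ∏ j ∈ block I b, (zvar i - zvar j - hvar)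

/-- `c_λ(z_I) = ∏_{a = 1}^{N-1} ∏_{i, j ∈ I_1 ∪ ⋯ ∪ I_a} (z_i - z_j - h)`
(the pairs with `i = j` are included). -/
def c (I : Partitions n lam) : RatZH n :=
  ∏ a ∈ Ico 1 N, ∏ i ∈ blockUnion I a, ∏ j ∈ blockUnion I a, (zvar i - zvar j - hvar)

/-- If `f = p / q` and `q` does not vanish under the substitution, then `subst I f` is the quotient
of the values of `p` and `q`. -/
theorem subst_div (I : Partitions n lam) (p q : MvPolynomial (TZHVar n lam) ℂ)
    (hq : substHom I q ≠ 0) :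
    subst I (algebraMap (MvPolynomial _ ℂ) _ p / algebraMap (MvPolynomial _ ℂ) _ q) = substHom I p / substHom I q := by
  set f : RatTZH n lam := algebraMap _ _ p / algebraMap _ _ q with hf
  have hq0 : q ≠ 0 := by rintro rfl; simp at hq
  have hinj := IsFractionRing.injective (MvPolynomial (TZHVar n lam) ℂ) (RatTZH n lam)
  have hqK : algebraMap _ (RatTZH n lam) q ≠ 0 := by
    simpa using (map_ne_zero_iff _ hinj).2 hq0
  have hdK : algebraMap _ (RatTZH n lam)
      (IsFractionRing.den (MvPolynomial (TZHVar n lam) ℂ) f : MvPolynomial _ ℂ) ≠ 0 :=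
    (map_ne_zero_iff _ hinj).2 (nonZeroDivisors.coe_ne_zero _)
  have hcross : IsFractionRing.num (MvPolynomial (TZHVar n lam) ℂ) f * q =
      p * (IsFractionRing.den (MvPolynomial (TZHVar n lam) ℂ) f : MvPolynomial _ ℂ) := by
    apply hinj
    rw [map_mul, map_mul, ← div_eq_div_iff hdK hqK, ← hf, ← IsFractionRing.mk'_eq_div,
      IsFractionRing.mk'_num_den]
  have hdvd : (IsFractionRing.den (MvPolynomial (TZHVar n lam) ℂ) f : MvPolynomial _ ℂ) ∣ q :=
    (IsFractionRing.num_den_reduced (MvPolynomial (TZHVar n lam) ℂ) f).symm.dvd_of_dvd_mul_left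
      ⟨p, by rw [hcross, mul_comm]⟩
  have hd : substHom I
      (IsFractionRing.den (MvPolynomial (TZHVar n lam) ℂ) f : MvPolynomial _ ℂ) ≠ 0 := by
    obtain ⟨e, he⟩ := hdvd
    intro h0
    exact hq (by rw [he, map_mul, h0, zero_mul])
  unfold subst
  rw [div_eq_div_iff hd hq, ← map_mul, ← map_mul, hcross]

/-- `Regular I f y`: the rational function `f` can be written with a denominator that does not
vanish under the substitution, and `f` takes the value `y`. -/
def Regular (I : Partitions n lam) (f : RatTZH n lam) (y : RatZH n) : Prop :=
  ∃ p q : MvPolynomial (TZHVar n lam) ℂ, substHom I q ≠ 0 ∧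
    f = algebraMap _ _ p / algebraMap _ _ q ∧ y = substHom I p / substHom I q

namespace Regular

variable {I : Partitions n lam} {f g : RatTZH n lam} {x y : RatZH n}

theorem subst_eq (hf : Regular I f x) : subst I f = x := by
  obtain ⟨p, q, hq, rfl, rfl⟩ := hf
  exact subst_div I p q hq

theorem algebraMap_ne_zero {q : MvPolynomial (TZHVar n lam) ℂ} (hq : substHom I q ≠ 0) :
    algebraMap _ (RatTZH n lam) q ≠ 0 := by
  refine (map_ne_zero_iff _ (IsFractionRing.injective _ _)).2 ?_
  rintro rfl
  simp at hq

theorem of_poly (p : MvPolynomial (TZHVar n lam) ℂ) :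
    Regular I (algebraMap _ _ p) (substHom I p) := ⟨p, 1, by simp, by simp, by simp⟩

theorem add (hf : Regular I f x) (hg : Regular I g y) : Regular I (f + g) (x + y) := by
  obtain ⟨p, q, hq, rfl, rfl⟩ := hf
  obtain ⟨r, s, hs, rfl, rfl⟩ := hg
  refine ⟨p * s + q * r, q * s, by simp [hq, hs], ?_, ?_⟩
  · rw [div_add_div _ _ (algebraMap_ne_zero hq) (algebraMap_ne_zero hs)]; simp
  · rw [div_add_div _ _ hq hs]; simp

theorem mul (hf : Regular I f x) (hg : Regular I g y) : Regular I (f * g) (x * y) := by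
  obtain ⟨p, q, hq, rfl, rfl⟩ := hf
  obtain ⟨r, s, hs, rfl, rfl⟩ := hg
  exact ⟨p * r, q * s, by simp [hq, hs], by simp [div_mul_div_comm], by simp [div_mul_div_comm]⟩

theorem neg (hf : Regular I f x) : Regular I (-f) (-x) := by
  obtain ⟨p, q, hq, rfl, rfl⟩ := hf
  exact ⟨-p, q, hq, by rw [map_neg, neg_div], by rw [map_neg, neg_div]⟩

theorem sub (hf : Regular I f x) (hg : Regular I g y) : Regular I (f - g) (x - y) := by
  simpa [sub_eq_add_neg] using hf.add hg.neg

theorem inv (hf : Regular I f x) (hx : x ≠ 0) : Regular I f⁻¹ x⁻¹ := by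
  obtain ⟨p, q, hq, rfl, rfl⟩ := hf
  refine ⟨q, p, ?_, by simp, by simp⟩
  intro h0
  simp [h0] at hx

theorem div (hf : Regular I f x) (hg : Regular I g y) (hy : y ≠ 0) :
    Regular I (f / g) (x / y) := by
  simpa [div_eq_mul_inv] using hf.mul (hg.inv hy)

theorem zero : Regular I 0 0 := by simpa using of_poly (I := I) 0

theorem one : Regular I 1 1 := by simpa using of_poly (I := I) 1

theorem sum {ι : Type*} (s : Finset ι) {F : ι → RatTZH n lam} {X : ι → RatZH n}
    (hF : ∀ i ∈ s, Regular I (F i) (X i)) : Regular I (∑ i ∈ s, F i) (∑ i ∈ s, X i) := by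
  induction s using Finset.cons_induction with
  | empty => simpa using zero
  | cons a s ha ih =>
    rw [Finset.sum_cons, Finset.sum_cons]
    exact (hF a (by simp)).add (ih fun i hi => hF i (by simp [hi]))

theorem prod {ι : Type*} (s : Finset ι) {F : ι → RatTZH n lam} {X : ι → RatZH n}
    (hF : ∀ i ∈ s, Regular I (F i) (X i)) : Regular I (∏ i ∈ s, F i) (∏ i ∈ s, X i) := by
  induction s using Finset.cons_induction with
  | empty => simpa using one
  | cons a s ha ih =>
    rw [Finset.prod_cons, Finset.prod_cons]
    exact (hF a (by simp)).mul (ih fun i hi => hF i (by simp [hi]))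

theorem pow (hf : Regular I f x) (k : ℕ) : Regular I (f ^ k) (x ^ k) := by
  simpa using prod (Finset.range k) (F := fun _ => f) (X := fun _ => x) fun _ _ => hf

end Regular

theorem zvar_injective : Function.Injective (zvar (n := n)) := by
  intro a b hab
  have h1 := MvPolynomial.X_injective
    (IsFractionRing.injective (MvPolynomial (ZHVar n) ℂ) (RatZH n) hab)
  simpa using h1

/-- The substituted weight function is given by the defining formula, evaluated at the substituted
values of the variables; no denominator vanishes there. -/
theorem subst_weightFunction (σ : Equiv.Perm (Fin n)) (I J : Partitions n lam) :
    subst I (weightFunction σ J) =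
      W (permInv σ J) (fun j a => zvar (enum I j a)) (fun a => zvar (σ a)) hvar := by
  apply Regular.subst_eq
  have hv (v : TZHVar n lam) : Regular I (var v) (substHom I (MvPolynomial.X v)) :=
    Regular.of_poly _
  have ht (j : {j // j ∈ Ico 1 N}) (a) : Regular I (var (TZHVar.t j a)) (zvar (enum I j a)) := by
    simpa [substHom] using hv (TZHVar.t j a)
  have hz (a : Fin n) : Regular I (var (TZHVar.z a)) (zvar a) := by
    simpa [substHom] using hv (TZHVar.z a)
  have hh : Regular I (var TZHVar.h) hvar := by simpa [substHom] using hv TZHVar.h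
  refine (hh.neg.pow _).mul (Regular.sum _ fun τ _ => ?_)
  have hl (j : ℕ) (a : Fin (partialSum lam j)) :
      Regular I
        (levels (permInv σ J) (fun j a => var (TZHVar.t j (τ j a)))
          (fun a => var (TZHVar.z (σ a))) j a)
        (levels (permInv σ J) (fun j a => zvar (enum I j (τ j a))) (fun a => zvar (σ a)) j a) := by
    unfold levels
    split_ifs with hj
    · exact ht _ _
    · exact hz _
  refine Regular.prod _ fun j hj => Regular.prod _ fun a _ => ?_
  refine ((Regular.prod _ fun c _ => ((hl _ _).sub (hl _ _)).sub hh).mul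
    (Regular.prod _ fun d _ => (hl _ _).sub (hl _ _))).mul
    (Regular.prod _ fun b hb => (((hl _ _).sub (hl _ _)).sub hh).div ((hl _ _).sub (hl _ _)) ?_)
  rw [sub_ne_zero]
  unfold levels
  rw [dif_pos hj, dif_pos hj]
  intro heq
  have := (τ ⟨j, hj⟩).injective ((enum I j).injective (zvar_injective heq))
  simp [this] at hb

end WeightFn

end

/-! For every ordering `σ` of the `z`-variables, `pairing σ J K` is shown to equal `δ_{J,K}`; the
theorem is the case `σ = 1`. Working with all `σ` at once is what makes an induction on `J`
possible.

Base case: `J` is monotone, so each union of its first blocks is an initial segment. By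
triangularity (`eq_permInv_of_weightAt_ne_zero`) the first weight function vanishes at all `z_I`
except the one with `J = σ⁻¹(I)`. At that `I` the second weight function, taken in the reversed
order, vanishes unless `K = J`. The surviving term is a quotient of explicit products, and
`prod_levelFactor_mul_rev` with `R_mul_Q_mul_c` shows that it is `1`.

Inductive step: for an adjacent transposition `s`, the exchange relation (`chainSum_exchange`)
expresses the weight function of `s(J)` through that of `J` in two orderings of `z`. Applied to both
factors of the pairing, it yields a linear relation in which the terms with coefficient `h` cancel,
since the pairing with `J` is already known not to depend on `σ`. Adjacent transpositions generate
the symmetric group, so every `J` is reached from a monotone one.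

The exchange relation is proved by recursion on levels. To make it visible, the variables of level
`j` are labelled by positions in `I_1 ∪ ⋯ ∪ I_j` rather than by numbers, and symmetrization becomes
a sum over bijective labellings (`chainSum`); a permutation of positions then acts on labellings
directly. -/

noncomputable section

namespace WeightFn

open Finset

/-! ### Weight functions labelled by positions, and the exchange relation. -/

section Chain

variable {α F : Type*} [LinearOrder α] [Fintype α] [Field F]

/-- The factor of `U` coupling the variable at the position `p` of level `j` to the variable at the
position `q` of level `j + 1`; `o` is the relative order of `p` and `q`, while `jp` and `jq` are the
block indices of `p` and `q`. -/
def crossFactor (h : F) (j : ℕ) (o : Ordering) (jp jq : ℕ) (up yq : F) : F :=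
  if jp < j ∧ jq < j + 1 then
    match o with
    | .lt => up - yq
    | .eq => 1
    | .gt => up - yq - h
  else 1

/-- The factor of `U` coupling the variables at the positions `p` and `q` of level `j`. -/
def selfFactor (h : F) (j : ℕ) (o : Ordering) (jp jq : ℕ) (up uq : F) : F :=
  if jp < j ∧ jq < j ∧ o = .lt then (up - uq - h) / (up - uq) else 1

/-- The product of the factors of `U` attached to a pair of positions. -/
def pairFactor (h : F) (j : ℕ) (J : α → ℕ) (u y : α → F) (x : α × α) : F :=
  crossFactor h j (cmp x.1 x.2) (J x.1) (J x.2) (u x.1) (y x.2) *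
    selfFactor h j (cmp x.1 x.2) (J x.1) (J x.2) (u x.1) (u x.2)

/-- The factor of `U` for a fixed level `j`, with variables labelled by positions. -/
def levelFactor (h : F) (j : ℕ) (J : α → ℕ) (u y : α → F) : F :=
  ∏ x : α × α, pairFactor h j J u y x

/-- The labelling of the variables of level `j` given by a bijection. -/
def labelling {J : α → ℕ} {j m : ℕ} (t : Fin m → F) (e : {p // J p < j} ≃ Fin m) (p : α) : F :=
  if hp : J p < j then t (e ⟨p, hp⟩) else 0

/-- The symmetrization of the products of level factors, level by level. -/
def chainSum (h : F) {m : ℕ → ℕ} (t : ∀ j, Fin (m j) → F) (J : α → ℕ) : ℕ → (α → F) → F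
  | 0, _ => 1
  | j + 1, y => ∑ e : {p // J p < j} ≃ Fin (m j),
      levelFactor h j J (labelling (t j) e) y * chainSum h t J j (labelling (t j) e)

/-- The part of `levelFactor` from all pairs of positions but `(a, b)` and `(b, a)`. -/
def levelRest (h : F) (j : ℕ) (a b : α) (J : α → ℕ) (u y : α → F) : F :=
  ∏ x ∈ (univ.erase (a, b)).erase (b, a), pairFactor h j J u y x

variable {h : F} {j : ℕ} {a b : α} {J : α → ℕ} {u y : α → F}

theorem levelFactor_eq_mul_levelRest (hab : a ≠ b) :
    levelFactor h j J u y =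
      pairFactor h j J u y (a, b) * pairFactor h j J u y (b, a) * levelRest h j a b J u y := by
  unfold levelFactor levelRest
  rw [mul_assoc, Finset.mul_prod_erase _ _ (by simp [hab.symm]), Finset.mul_prod_erase _ _ (by simp)]

-- No position lies strictly between `a` and `b`, so their exchange affects no comparison except
-- that of `a` with `b`.
omit [Fintype α] in
theorem cmp_swap_apply (hab : a < b) (hadj : ∀ p, p ≠ a → p ≠ b → (p < a ↔ p < b)) {p q : α}
    (h1 : ¬(p = a ∧ q = b)) (h2 : ¬(p = b ∧ q = a)) :
    cmp (Equiv.swap a b p) (Equiv.swap a b q) = cmp p q := by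
  have key (p q : α) (h1 : ¬(p = a ∧ q = b)) (h2 : ¬(p = b ∧ q = a)) :
      Equiv.swap a b p < Equiv.swap a b q ↔ p < q := by
    simp only [Equiv.swap_apply_def]
    have hp := hadj p
    have hq := hadj q
    split_ifs <;> grind
  rw [eq_comm]
  apply (cmp_eq_cmp_symm.2 ?_)
  have e1 := key p q h1 h2
  have e2 := key q p (by tauto) (by tauto)
  simp only [cmp, cmpUsing, e1, e2]

theorem levelRest_comp_swap (hab : a < b) (hadj : ∀ p, p ≠ a → p ≠ b → (p < a ↔ p < b)) :
    levelRest h j a b (J ∘ Equiv.swap a b) (u ∘ Equiv.swap a b) (y ∘ Equiv.swap a b) =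
      levelRest h j a b J u y := by
  unfold levelRest
  refine Finset.prod_equiv ((Equiv.swap a b).prodCongr (Equiv.swap a b)) ?_ ?_
  · rintro ⟨p, q⟩
    simp only [mem_erase, mem_univ, and_true, ne_eq, Prod.mk.injEq, Equiv.prodCongr_apply,
      Prod.map_apply, Equiv.swap_apply_eq_iff, Equiv.swap_apply_left, Equiv.swap_apply_right]
    tauto
  · rintro ⟨p, q⟩ hpq
    simp only [mem_erase, mem_univ, and_true, ne_eq, Prod.mk.injEq] at hpq
    simp [pairFactor, cmp_swap_apply hab hadj hpq.2 hpq.1]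

/-- For `p` outside `{a, b}`, the pairs `(p, a)` and `(p, b)` compare alike and just trade places.
For `p` in `{a, b}` only the pair `(p, p)` could feel the swap, and its cross factor is `1`. -/
theorem levelRest_swap_right (hab : a < b) (hadj : ∀ p, p ≠ a → p ≠ b → (p < a ↔ p < b))
    (ha : J a < j + 1) (hb : J b < j + 1) :
    levelRest h j a b J u (y ∘ Equiv.swap a b) = levelRest h j a b J u y := by
  unfold levelRest pairFactor
  simp only [Finset.prod_mul_distrib]
  congr 1
  have hJ (q : α) : J (Equiv.swap a b q) < j + 1 ↔ J q < j + 1 := by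
    simp only [Equiv.swap_apply_def]
    split_ifs <;> simp_all
  let i : α × α → α × α := fun x => if x.1 = a ∨ x.1 = b then x else (x.1, Equiv.swap a b x.2)
  have hi (x : α × α) : i (i x) = x := by
    by_cases hx : x.1 = a ∨ x.1 = b <;> simp [i, hx]
  have hmem (x : α × α) (hx : x ∈ (univ.erase (a, b)).erase (b, a)) :
      i x ∈ (univ.erase (a, b)).erase (b, a) := by
    by_cases hx' : x.1 = a ∨ x.1 = b
    · simpa only [i, hx', if_true] using hx
    · simp only [i, hx', if_false, mem_erase, mem_univ, and_true, ne_eq, Prod.mk.injEq]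
      tauto
  refine Finset.prod_nbij' i i hmem hmem (fun x _ => hi x) (fun x _ => hi x) ?_
  rintro ⟨p, q⟩ hpq
  simp only [mem_erase, mem_univ, and_true, ne_eq, Prod.mk.injEq] at hpq
  by_cases hx : p = a ∨ p = b
  · simp only [i, hx, if_true, Function.comp_apply]
    by_cases hqp : q = p
    · simp [crossFactor, hqp]
    · rw [Equiv.swap_apply_of_ne_of_ne] <;> grind
  · have hp : Equiv.swap a b p = p := Equiv.swap_apply_of_ne_of_ne (by tauto) (by tauto)
    have := cmp_swap_apply hab hadj hpq.2 hpq.1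
    rw [hp] at this
    simp only [i, hx, if_false, Function.comp_apply, crossFactor, this, hJ]

theorem levelRest_swap_left (hab : a < b) (hadj : ∀ p, p ≠ a → p ≠ b → (p < a ↔ p < b))
    (ha : J a < j) (hb : J b < j) :
    levelRest h j a b J (u ∘ Equiv.swap a b) y = levelRest h j a b J u y := by
  -- Swapping `u` alone amounts to swapping everything and then swapping `y` back; `J` enters only
  -- through memberships that `a` and `b` share.
  rw [← levelRest_swap_right hab hadj (by lia) (by lia),
    ← levelRest_comp_swap (u := u) hab hadj]
  have hJ (q : α) : J (Equiv.swap a b q) < j ↔ J q < j := by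
    simp only [Equiv.swap_apply_def]
    split_ifs <;> simp_all
  have hJ' (q : α) : J (Equiv.swap a b q) < j + 1 ↔ J q < j + 1 := by
    simp only [Equiv.swap_apply_def]
    split_ifs <;> grind
  unfold levelRest pairFactor crossFactor selfFactor
  simp only [Function.comp_apply, hJ, hJ']

/-- A permutation `s` of the positions acts on bijective labellings. -/
def labelEquiv (s : Equiv.Perm α) (J : α → ℕ) (j m : ℕ) :
    ({p // J p < j} ≃ Fin m) ≃ ({p // (J ∘ s) p < j} ≃ Fin m) :=
  Equiv.equivCongr (s.subtypeEquiv (p := fun p => (J ∘ s) p < j) (q := fun p => J p < j)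
    (fun _ => Iff.rfl)).symm (Equiv.refl _)

omit [LinearOrder α] [Fintype α] in
theorem labelling_labelEquiv (s : Equiv.Perm α) {m : ℕ} (t : Fin m → F)
    (e : {p // J p < j} ≃ Fin m) :
    labelling t (labelEquiv s J j m e) = labelling t e ∘ s := by
  ext p
  simp only [labelling, labelEquiv, Function.comp_apply]
  rfl

theorem chainSum_comp_succ (s : Equiv.Perm α) {m : ℕ → ℕ} (t : ∀ j, Fin (m j) → F) :
    chainSum h t (J ∘ s) (j + 1) y = ∑ e : {p // J p < j} ≃ Fin (m j),
      levelFactor h j (J ∘ s) (labelling (t j) e ∘ s) y *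
        chainSum h t (J ∘ s) j (labelling (t j) e ∘ s) := by
  rw [chainSum, ← Equiv.sum_comp (labelEquiv s J j (m j))]
  simp only [labelling_labelEquiv]

/-- When `a` and `b` are not both present at level `j`, no factor couples them at any level below,
so their relative order is irrelevant. -/
theorem chainSum_comp_swap (hab : a < b) (hadj : ∀ p, p ≠ a → p ≠ b → (p < a ↔ p < b))
    {m : ℕ → ℕ} (t : ∀ j, Fin (m j) → F) (hJ : ¬(J a < j ∧ J b < j)) :
    chainSum h t (J ∘ Equiv.swap a b) j (y ∘ Equiv.swap a b) = chainSum h t J j y := by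
  induction j generalizing y with
  | zero => rfl
  | succ j ih =>
    rw [chainSum_comp_succ, chainSum]
    refine Finset.sum_congr rfl fun e _ => ?_
    rw [ih (by lia), levelFactor_eq_mul_levelRest hab.ne, levelFactor_eq_mul_levelRest hab.ne,
      levelRest_comp_swap hab hadj]
    have h1 : ¬(J a < j ∧ J b ≤ j) := by lia
    have h2 : ¬(J b < j ∧ J a ≤ j) := by lia
    have h3 (P : Prop) : ¬(J a < j ∧ J b < j ∧ P) := by lia
    have h4 (P : Prop) : ¬(J b < j ∧ J a < j ∧ P) := by lia
    simp [pairFactor, crossFactor, selfFactor, h1, h2, h3, h4]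

/-- The exchange relation for a transposition of adjacent positions. -/
theorem chainSum_exchange (hab : a < b) (hadj : ∀ p, p ≠ a → p ≠ b → (p < a ↔ p < b))
    {m : ℕ → ℕ} {t : ∀ j, Fin (m j) → F} (ht : ∀ j, Function.Injective (t j))
    (ha : J a < j) (hb : J b < j) :
    (y a - y b + h) * chainSum h t J j (y ∘ Equiv.swap a b) =
      h * chainSum h t J j y + (y a - y b) * chainSum h t (J ∘ Equiv.swap a b) j y := by
  induction j generalizing y with
  | zero => lia
  | succ j ih =>
    have hcab : cmp a b = .lt := cmp_eq_lt_iff _ _ |>.2 hab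
    have hcba : cmp b a = .gt := cmp_eq_gt_iff _ _ |>.2 hab
    have hrest (u : α → F) : levelRest h j a b (J ∘ Equiv.swap a b) (u ∘ Equiv.swap a b) y =
        levelRest h j a b J u y := by
      have := levelRest_comp_swap (h := h) (j := j) (J := J) (u := u) (y := y ∘ Equiv.swap a b)
        hab hadj
      rw [levelRest_swap_right hab hadj ha hb] at this
      rw [← this]
      congr 1
      ext p
      simp
    rw [chainSum_comp_succ]
    simp only [chainSum]
    simp only [levelFactor_eq_mul_levelRest hab.ne, levelRest_swap_right hab hadj ha hb, hrest]
    -- If both positions survive to level `j`, the relation for lower levels is needed; otherwise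
    -- the lower part is invariant and the relation is an identity between the factors of the pair
    -- `a`, `b`.
    by_cases hJ : J a < j ∧ J b < j
    · set s := Equiv.swap a b with hs
      have hss (u : α → F) : (u ∘ s) ∘ s = u := by ext p; simp [hs]
      have hne (e : {p // J p < j} ≃ Fin (m j)) : labelling (t j) e a - labelling (t j) e b ≠ 0 := by
        rw [sub_ne_zero]
        simp only [labelling, hJ.1, hJ.2, dif_pos]
        intro heq
        have := e.injective (ht j heq)
        exact hab.ne (by simpa using this)
      have hsum (f : (α → F) → F) : ∑ e : {p // J p < j} ≃ Fin (m j), f (labelling (t j) e) =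
          ∑ e : {p // J p < j} ≃ Fin (m j), f (labelling (t j) e ∘ s) := by
        have hmem (p : α) : J (s p) < j ↔ J p < j := by
          simp only [hs, Equiv.swap_apply_def]
          split_ifs <;> simp_all
        rw [← Equiv.sum_comp (Equiv.equivCongr (s.subtypeEquiv (p := fun p => J p < j)
          (q := fun p => J p < j) (fun p => (hmem p).symm)).symm
          (Equiv.refl (Fin (m j))))]
        refine Finset.sum_congr rfl fun e _ => ?_
        congr 1
        ext p
        by_cases hp : J p < j
        · simp only [labelling, hp, (hmem p).2 hp, dif_pos, Function.comp_apply]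
          rfl
        · simp [labelling, hp, hmem]
      have ih' (e : {p // J p < j} ≃ Fin (m j)) :
          chainSum h t (J ∘ s) j (labelling (t j) e ∘ s) =
            ((labelling (t j) e b - labelling (t j) e a + h) * chainSum h t J j (labelling (t j) e)
              - h * chainSum h t J j (labelling (t j) e ∘ s)) /
              (labelling (t j) e b - labelling (t j) e a) := by
        have := ih (y := labelling (t j) e ∘ s) hJ.1 hJ.2
        rw [hss] at this
        simp only [hs, Function.comp_apply, Equiv.swap_apply_left, Equiv.swap_apply_right] at this
        rw [eq_div_iff (by rw [← neg_sub, neg_ne_zero]; exact hne e), hs, this]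
        ring
      -- `B` collects the terms in which the induction hypothesis produces the lower sum at `u ∘ s`.
      -- Reindexing them by `u ↦ u ∘ s` leaves every summand a multiple of the same lower sum at
      -- `u`, so that the coefficients can be compared labelling by labelling.
      let B (u : α → F) : F := (u b - y b) * (u b - u a - h) / (u b - u a) ^ 2 * (u a - y a - h) *
        levelRest h j a b J u y * h * chainSum h t J j (u ∘ s)
      have hB := hsum B
      have hP : ∑ e : {p // J p < j} ≃ Fin (m j),
          (pairFactor h j (J ∘ s) (labelling (t j) e ∘ s) y (a, b) *
            pairFactor h j (J ∘ s) (labelling (t j) e ∘ s) y (b, a) *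
            levelRest h j a b J (labelling (t j) e) y) *
            chainSum h t (J ∘ s) j (labelling (t j) e ∘ s) =
          ∑ e : {p // J p < j} ≃ Fin (m j),
            (((labelling (t j) e b - y b) * (labelling (t j) e b - labelling (t j) e a - h) *
              (labelling (t j) e a - y a - h) * levelRest h j a b J (labelling (t j) e) y *
              (labelling (t j) e b - labelling (t j) e a + h) * chainSum h t J j (labelling (t j) e)
              / (labelling (t j) e b - labelling (t j) e a) ^ 2) - B (labelling (t j) e ∘ s)) := by
        rw [Finset.sum_sub_distrib, ← hB, ← Finset.sum_sub_distrib]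
        refine Finset.sum_congr rfl fun e _ => ?_
        have h1 := hne e
        have h2 : labelling (t j) e b - labelling (t j) e a ≠ 0 := by
          rwa [← neg_sub, neg_ne_zero]
        rw [ih' e]
        simp only [pairFactor, crossFactor, selfFactor, hcab, hcba, hs, Function.comp_apply,
          Equiv.swap_apply_left, Equiv.swap_apply_right, ha, hb, hJ.1, hJ.2, B, and_self, if_true,
          reduceCtorEq, and_false, if_false]
        field_simp
      rw [hP, Finset.mul_sum, Finset.mul_sum, Finset.mul_sum, ← Finset.sum_add_distrib]
      refine Finset.sum_congr rfl fun e _ => ?_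
      have h1 := hne e
      have h2 : labelling (t j) e b - labelling (t j) e a ≠ 0 := by
        rwa [← neg_sub, neg_ne_zero]
      simp only [B, hss]
      rw [hs, levelRest_swap_left hab hadj hJ.1 hJ.2]
      simp only [pairFactor, crossFactor, selfFactor, hcab, hcba, Function.comp_apply,
        Equiv.swap_apply_left, Equiv.swap_apply_right, ha, hb, hJ.1, hJ.2, and_self, if_true,
        reduceCtorEq, and_false, if_false, mul_one]
      generalize labelling (t j) e a = ua at *
      generalize labelling (t j) e b = ub at *
      have h3 : ub - ua = -(ua - ub) := by ring
      rw [h3, neg_sq]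
      field_simp
      ring
    · rw [Finset.mul_sum, Finset.mul_sum, Finset.mul_sum, ← Finset.sum_add_distrib]
      refine Finset.sum_congr rfl fun e _ => ?_
      rw [chainSum_comp_swap hab hadj t hJ]
      set C := levelRest h j a b J (labelling (t j) e) y
      set D := chainSum h t J j (labelling (t j) e)
      by_cases ha' : J a < j
      · have hb' : ¬ J b < j := by tauto
        simp [pairFactor, crossFactor, selfFactor, ha, hb, ha', hb', hcab, hcba]
        ring
      · by_cases hb' : J b < j
        · simp [pairFactor, crossFactor, selfFactor, ha, hb, ha', hb', hcab, hcba]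
          ring
        · simp [pairFactor, crossFactor, selfFactor, ha, hb, ha', hb', hcab, hcba]
          ring

end Chain

/-! ### Identification of `W` with the position-labelled sum. -/

section Connect

variable {N n : ℕ} {lam : Fin N → ℕ} {F : Type*} [Field F]

/-- The block index of a position, as a natural number. -/
def blockIndex (I : Partitions n lam) (p : Fin n) : ℕ := (I.1 p).val

/-- The factor of `U` for a fixed level, with variables labelled by their numbers. -/
def enumFactor (h : F) (I : Partitions n lam) (j : ℕ) (u : Fin (partialSum lam j) → F)
    (v : Fin (partialSum lam (j + 1)) → F) : F :=
  ∏ a : Fin (partialSum lam j),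
    ((∏ c with enum I (j + 1) c < enum I j a, (u a - v c - h)) *
      (∏ d with enum I j a < enum I (j + 1) d, (u a - v d)) *
      ∏ b with a < b, (u a - u b - h) / (u a - u b))

theorem prod_enum (I : Partitions n lam) (j : ℕ) (f : Fin n → F) :
    ∏ a, f (enum I j a) = ∏ p, if blockIndex I p < j then f p else 1 := by
  rw [← Finset.prod_filter]
  have : ({p | blockIndex I p < j} : Finset (Fin n)) = univ.map (enum I j).toEmbedding := by
    rw [enum, Finset.map_orderEmbOfFin_univ]
    rfl
  rw [this, Finset.prod_map]
  rfl

/-- The numbering of the positions in `I_1 ∪ ⋯ ∪ I_j`. -/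
def enumEquiv (I : Partitions n lam) (j : ℕ) :
    Fin (partialSum lam j) ≃ {p // blockIndex I p < j} :=
  ((blockUnion I j).orderIsoOfFin (card_blockUnion I j)).toEquiv.trans
    (Equiv.subtypeEquivRight (by simp [blockUnion, blockIndex]))

theorem blockIndex_enum_lt (I : Partitions n lam) (j : ℕ) (a : Fin (partialSum lam j)) :
    blockIndex I (enum I j a) < j := (enumEquiv I j a).2

theorem enumFactor_eq_levelFactor (h : F) (I : Partitions n lam) (j : ℕ) (u y : Fin n → F) :
    enumFactor h I j (u ∘ enum I j) (y ∘ enum I (j + 1)) =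
      levelFactor h j (blockIndex I) u y := by
  unfold enumFactor levelFactor
  rw [Fintype.prod_prod_type]
  simp only [Finset.prod_filter, Function.comp_apply]
  have key (a : Fin (partialSum lam j)) :
      ((∏ c, (if enum I (j + 1) c < enum I j a then
          u (enum I j a) - y (enum I (j + 1) c) - h else 1)) *
        (∏ d, (if enum I j a < enum I (j + 1) d then
          u (enum I j a) - y (enum I (j + 1) d) else 1)) *
        ∏ b, (if a < b then (u (enum I j a) - u (enum I j b) - h) /
          (u (enum I j a) - u (enum I j b)) else 1)) =
      ∏ q, pairFactor h j (blockIndex I) u y (enum I j a, q) := by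
    have hp := blockIndex_enum_lt I j a
    -- The enumeration is increasing, so the condition `a < b` on numbers becomes one on positions.
    simp only [← OrderEmbedding.lt_iff_lt (enum I j)]
    generalize enum I j a = p at *
    rw [prod_enum I (j + 1) (fun c => if c < p then u p - y c - h else 1),
      prod_enum I (j + 1) (fun c => if p < c then u p - y c else 1),
      prod_enum I j (fun c => if p < c then (u p - u c - h) / (u p - u c) else 1),
      ← Finset.prod_mul_distrib, ← Finset.prod_mul_distrib]
    refine Finset.prod_congr rfl fun q _ => ?_
    rcases lt_trichotomy p q with hpq | rfl | hpq
    · have hc : cmp p q = .lt := (cmp_eq_lt_iff _ _).2 hpq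
      simp only [pairFactor, crossFactor, selfFactor, hc, hp, hpq, hpq.not_gt, true_and, if_true,
        if_false, and_true, ite_self, one_mul]
    · simp [pairFactor, crossFactor, selfFactor]
    · have hc : cmp p q = .gt := (cmp_eq_gt_iff _ _).2 hpq
      simp only [pairFactor, crossFactor, selfFactor, hc, hp, hpq, hpq.not_gt, true_and, if_true,
        if_false, reduceCtorEq, and_false, ite_self, mul_one]
  rw [Finset.prod_congr rfl fun a _ => key a,
    prod_enum I j (fun p => ∏ q, pairFactor h j (blockIndex I) u y (p, q))]
  refine Finset.prod_congr rfl fun p _ => ?_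
  split_ifs with hp
  · rfl
  · exact (Finset.prod_eq_one fun q _ => by
      simp [pairFactor, crossFactor, selfFactor, hp]).symm

theorem chainSum_succ_eq_sum_perm (h : F) (I : Partitions n lam)
    (t : ∀ j, Fin (partialSum lam j) → F) (j : ℕ) (y : Fin n → F) :
    chainSum h t (blockIndex I) (j + 1) y =
      ∑ τ : Equiv.Perm (Fin (partialSum lam j)),
        enumFactor h I j (t j ∘ τ) (y ∘ enum I (j + 1)) *
          chainSum h t (blockIndex I) j (labelling (t j) ((enumEquiv I j).symm.trans τ)) := by
  rw [chainSum, ← Equiv.sum_comp (Equiv.equivCongr (enumEquiv I j) (Equiv.refl _))]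
  refine Finset.sum_congr rfl fun τ _ => ?_
  have h1 : labelling (t j) ((enumEquiv I j).symm.trans τ) ∘ enum I j = t j ∘ τ := by
    ext a
    have h2 : (enumEquiv I j).symm ⟨enum I j a, blockIndex_enum_lt I j a⟩ = a :=
      (Equiv.symm_apply_eq _).2 rfl
    simp [labelling, blockIndex_enum_lt, h2]
  have h2 : (Equiv.equivCongr (enumEquiv I j) (Equiv.refl (Fin (partialSum lam j)))) τ =
    (enumEquiv I j).symm.trans τ := rfl
  rw [h2, ← h1, enumFactor_eq_levelFactor]

theorem levelFactor_congr {α : Type*} [LinearOrder α] [Fintype α] {h : F} {j : ℕ} {J : α → ℕ}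
    {u u' y y' : α → F} (hu : ∀ p, J p < j → u p = u' p) (hy : ∀ p, J p < j + 1 → y p = y' p) :
    levelFactor h j J u y = levelFactor h j J u' y' := by
  refine Finset.prod_congr rfl fun x _ => ?_
  unfold pairFactor crossFactor selfFactor
  congr 1
  · split_ifs with hx
    · rw [hu _ hx.1, hy _ hx.2]
    · rfl
  · split_ifs with hx
    · rw [hu _ hx.1, hu _ hx.2.1]
    · rfl

/-- Values outside the level never enter; in particular the default `0` in `labelling` is harmless.
-/
theorem chainSum_congr {α : Type*} [LinearOrder α] [Fintype α] {h : F} {m : ℕ → ℕ}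
    {t : ∀ j, Fin (m j) → F} {J : α → ℕ} {j : ℕ} {y y' : α → F}
    (hy : ∀ p, J p < j → y p = y' p) : chainSum h t J j y = chainSum h t J j y' := by
  cases j with
  | zero => rfl
  | succ j =>
    exact Finset.sum_congr rfl fun e _ => by rw [levelFactor_congr (fun _ _ => rfl) hy]

theorem chainSum_one (h : F) (I : Partitions n lam) (t : ∀ j, Fin (partialSum lam j) → F)
    (y : Fin n → F) : chainSum h t (blockIndex I) 1 y = 1 := by
  have : IsEmpty (Fin (partialSum lam 0)) := by
    simp only [partialSum, Nat.not_lt_zero, Finset.filter_false, Finset.sum_empty]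
    infer_instance
  rw [chainSum_succ_eq_sum_perm]
  simp [enumFactor, chainSum]

/-- The variables of level `j`, given by `τ` below level `M` and by `x` from there on. -/
def extend {X : ℕ → Type*} {M : ℕ} (τ : ∀ j : {j // j ∈ Ico 1 M}, X j) (x : ∀ j, X j) (j : ℕ) :
    X j :=
  if hj : j ∈ Ico 1 M then τ ⟨j, hj⟩ else x j

/-- Splitting off the last entry of a family indexed by `1, …, M`. -/
def splitLast (X : ℕ → Type*) {M : ℕ} (hM : 1 ≤ M) :
    X M × (∀ j : {j // j ∈ Ico 1 M}, X j) ≃ (∀ j : {j // j ∈ Ico 1 (M + 1)}, X j) where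
  toFun x j := if hj : j.1 = M then cast (congrArg X hj.symm) x.1 else
    x.2 ⟨j.1, by have := j.2; simp only [mem_Ico] at this ⊢; lia⟩
  invFun τ := (τ ⟨M, by simp only [mem_Ico]; lia⟩,
    fun j => τ ⟨j.1, by have := j.2; simp only [mem_Ico] at this ⊢; lia⟩)
  left_inv x := by
    ext j
    · simp
    · have := j.2
      simp only [mem_Ico] at this
      simp [this.2.ne]
  right_inv τ := by
    ext j
    obtain ⟨j, hj⟩ := j
    by_cases h : j = M
    · subst h; simp
    · simp [h]

/-- The simultaneous sum over all permutations is unfolded one level at a time. Only the value `x M`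
matters, as the boundary data at the top level; keeping `x` and `y` general lets the induction
replace them by the permuted variables of the level just split off. -/
theorem sum_prod_enumFactor (h : F) (I : Partitions n lam) (t : ∀ j, Fin (partialSum lam j) → F)
    {M : ℕ} (hM : 1 ≤ M) (x : ∀ j, Fin (partialSum lam j) → F) (y : Fin n → F)
    (hy : y ∘ enum I M = x M) :
    ∑ τ : (∀ j : {j // j ∈ Ico 1 M}, Equiv.Perm (Fin (partialSum lam j))),
      ∏ j ∈ Ico 1 M, enumFactor h I j
        (extend (X := fun j => Fin (partialSum lam j) → F) (fun j => t j ∘ τ j) x j)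
        (extend (X := fun j => Fin (partialSum lam j) → F) (fun j => t j ∘ τ j) x (j + 1)) =
    chainSum h t (blockIndex I) M y := by
  induction M, hM using Nat.le_induction generalizing x y with
  | base =>
    simp only [Ico_self, prod_empty, sum_const, card_univ, chainSum_one, Fintype.card_pi]
    simpa using Finset.prod_eq_one fun i _ => absurd i.2 (by simp)
  | succ M hM ih =>
    rw [chainSum_succ_eq_sum_perm,
      ← Equiv.sum_comp (splitLast (fun j => Equiv.Perm (Fin (partialSum lam j))) hM),
      Fintype.sum_prod_type]
    refine Finset.sum_congr rfl fun τ _ => ?_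
    have hlab : labelling (t M) ((enumEquiv I M).symm.trans τ) ∘ enum I M = t M ∘ τ := by
      ext a
      have h2 : (enumEquiv I M).symm ⟨enum I M a, blockIndex_enum_lt I M a⟩ = a :=
        (Equiv.symm_apply_eq _).2 rfl
      simp [labelling, blockIndex_enum_lt, h2]
    rw [← ih (Function.update x M (t M ∘ τ)) _ (by rw [hlab]; simp), Finset.mul_sum]
    refine Finset.sum_congr rfl fun τ' _ => ?_
    rw [Finset.prod_Ico_succ_top hM, mul_comm]
    have e1 (j : ℕ) (hj : j ∈ Ico 1 (M + 1)) :
        extend (X := fun j => Fin (partialSum lam j) → F) (M := M + 1)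
          (fun j => t j ∘ (splitLast (fun j => Equiv.Perm (Fin (partialSum lam j))) hM (τ, τ')) j)
          x j =
        extend (X := fun j => Fin (partialSum lam j) → F) (M := M) (fun j => t j ∘ τ' j)
          (Function.update x M (t M ∘ τ)) j := by
      by_cases h : j = M
      · subst h
        simp [extend, splitLast, hM]
      · simp only [mem_Ico] at hj
        have h1 : 1 ≤ j ∧ j < M := by lia
        have h2 : 1 ≤ j ∧ j < M + 1 := by lia
        simp [extend, splitLast, h1, h2, h]
    congr 1
    · rw [e1 M (by simp only [mem_Ico]; lia), hy]
      congr 1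
      · simp [extend]
      · simp [extend]
    · refine Finset.prod_congr rfl fun j hj => ?_
      simp only [mem_Ico] at hj
      rw [e1 j (by simp only [mem_Ico]; lia), e1 (j + 1) (by simp only [mem_Ico]; lia)]

theorem enum_top (I : Partitions n lam) (a : Fin (partialSum lam N)) :
    enum I N a = Fin.castLE (partialSum_le I N) a := by
  have hN : partialSum lam N = n := by
    rw [← card_blockUnion I N]
    simp [blockUnion]
  have := Finset.orderEmbOfFin_unique (card_blockUnion I N)
    (f := Fin.castLE (partialSum_le I N)) (by simp [blockUnion])
    (Fin.strictMono_castLE _)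
  exact (congrFun this a).symm

theorem W_eq_chainSum (I : Partitions n lam) (t : ∀ j, Fin (partialSum lam j) → F) (z : Fin n → F)
    (h : F) :
    W I (fun j a => t j a) z h = (-h) ^ (∑ j ∈ Ico 1 N, partialSum lam j) *
      chainSum h t (blockIndex I) N z := by
  unfold W
  congr 1
  rcases Nat.eq_zero_or_pos N with rfl | hN
  · simp [U, chainSum]
    exact Finset.prod_eq_one fun i _ => absurd i.2 (by simp)
  · rw [← sum_prod_enumFactor h I t hN
      (fun j a => z (Fin.castLE (partialSum_le I j) a)) z (by ext a; simp [enum_top])]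
    refine Finset.sum_congr rfl fun τ _ => Finset.prod_congr rfl fun j _ => ?_
    have hl (j : ℕ) : levels I (fun j a => t j (τ j a)) z j =
        extend (X := fun j => Fin (partialSum lam j) → F) (fun j => t j ∘ τ j)
          (fun j a => z (Fin.castLE (partialSum_le I j) a)) j := by
      ext a
      unfold levels extend
      split_ifs <;> rfl
    simp only [hl]
    rfl

end Connect

/-! ### Triangularity of the substituted sums. -/

section Triangular

variable {n : ℕ} {F : Type*} [Field F] {h : F} {I K : Fin n → ℕ} {m : ℕ → ℕ}
  {ρ : ∀ j, Fin (m j) → Fin n} {y : Fin n → F} {j : ℕ}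

/-- A termwise inequality between two families forces termwise equality once the sums are compared
the other way. -/
theorem eq_of_le_of_sum_le {k : ℕ} {r : Fin k → Fin n} (hr : Function.Injective r)
    (hrange : ∀ q, I q < j ↔ q ∈ Set.range r)
    (hsum : ∑ p with K p < j, p.val ≤ ∑ p with I p < j, p.val)
    (e : {p // K p < j} ≃ Fin k) (hle : ∀ p, r (e p) ≤ p.1) (p : {p // K p < j}) :
    r (e p) = p.1 := by
  have h1 : ∑ p with I p < j, p.val = ∑ p : {p // K p < j}, (r (e p)).val := by
    rw [Equiv.sum_comp e (fun a => (r a).val)]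
    have : ({p | I p < j} : Finset (Fin n)) = univ.map ⟨r, hr⟩ := by
      ext q; simp [hrange]
    rw [this, Finset.sum_map]
    rfl
  have h2 : ∑ p with K p < j, p.val = ∑ p : {p // K p < j}, p.1.val :=
    Finset.sum_subtype _ (by simp) _
  have h0 (p : {p // K p < j}) : (r (e p)).val ≤ p.1.val := hle p
  have h3 := Finset.sum_le_sum (s := univ) fun p _ => h0 p
  have h4 := (Finset.sum_eq_sum_iff_of_le fun p _ => h0 p).1
    (le_antisymm h3 (by rw [← h1, ← h2]; exact hsum))
  exact Fin.ext (h4 p (mem_univ p))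

/-- If the variable put at `p` were `y q` with `q > p`, the factor `y q - y q` would occur. So a
nonzero term only moves positions down, and `hsum` leaves no room to move. -/
theorem eq_of_levelFactor_ne_zero (hρ : ∀ j, Function.Injective (ρ j))
    (hrange : ∀ q, I q < j ↔ q ∈ Set.range (ρ j))
    (hsum : ∑ p with K p < j, p.val ≤ ∑ p with I p < j, p.val)
    (htop : ∀ p, K p < j + 1 ↔ I p < j + 1) (e : {p // K p < j} ≃ Fin (m j))
    (hne : levelFactor h j K (labelling (y ∘ ρ j) e) y ≠ 0) (p : {p // K p < j}) :
    ρ j (e p) = p.1 := by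
  refine eq_of_le_of_sum_le (hρ j) hrange hsum e (fun p => ?_) p
  by_contra! hlt
  refine hne (Finset.prod_eq_zero (mem_univ (p.1, ρ j (e p))) ?_)
  have hc : cmp p.1 (ρ j (e p)) = .lt := (cmp_eq_lt_iff _ _).2 hlt
  have h1 : I (ρ j (e p)) < j := (hrange _).2 ⟨_, rfl⟩
  have h2 : K (ρ j (e p)) < j + 1 := (htop _).2 (by lia)
  simp [pairFactor, crossFactor, hc, p.2, h2, labelling]

/-- Triangularity: the labels of the substituted variables have to fill the same positions. -/
theorem lt_iff_of_chainSum_ne_zero (hρ : ∀ j, Function.Injective (ρ j))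
    (hrange : ∀ j q, I q < j ↔ q ∈ Set.range (ρ j))
    (hsum : ∀ j, ∑ p with K p < j, p.val ≤ ∑ p with I p < j, p.val)
    (htop : ∀ p, K p < j ↔ I p < j) (hne : chainSum h (fun j => y ∘ ρ j) K j y ≠ 0) {i : ℕ}
    (hi : i ≤ j) (p : Fin n) : K p < i ↔ I p < i := by
  induction j with
  | zero => rw [Nat.le_zero.1 hi]; simp
  | succ j ih =>
    rcases hi.eq_or_lt with rfl | hi
    · exact htop p
    · obtain ⟨e, -, he⟩ := Finset.exists_ne_zero_of_sum_ne_zero hne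
      have heq := eq_of_levelFactor_ne_zero hρ (hrange j) (hsum j) htop e (left_ne_zero_of_mul he)
      have hiff (p : Fin n) : K p < j ↔ I p < j := by
        rw [hrange]
        constructor
        · exact fun hp => ⟨_, heq ⟨p, hp⟩⟩
        · rintro ⟨a, rfl⟩
          have := heq (e.symm a)
          rw [e.apply_symm_apply] at this
          rw [this]
          exact (e.symm a).2
      have hy : chainSum h (fun j => y ∘ ρ j) K j y ≠ 0 := by
        rw [← chainSum_congr (y := labelling (y ∘ ρ j) e)]
        · exact right_ne_zero_of_mul he
        · intro p hp
          simp [labelling, hp, heq]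
      exact ih hiff hy (by lia)

/-- When the substituted positions are those of `K` itself, triangularity kills every labelling
except the one placing `y p` at `p`. -/
theorem chainSum_eq_prod (hρ : ∀ j, Function.Injective (ρ j))
    (hrange : ∀ j q, K q < j ↔ q ∈ Set.range (ρ j)) (j : ℕ) :
    chainSum h (fun j => y ∘ ρ j) K j y = ∏ i ∈ range j, levelFactor h i K y y := by
  induction j with
  | zero => rfl
  | succ j ih =>
    let r : Fin (m j) → {p // K p < j} := fun a => ⟨ρ j a, (hrange j _).2 ⟨a, rfl⟩⟩
    have hr : Function.Bijective r := by
      constructor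
      · intro a b hab
        exact hρ j (congrArg Subtype.val hab)
      · rintro ⟨p, hp⟩
        obtain ⟨a, rfl⟩ := (hrange j p).1 hp
        exact ⟨a, rfl⟩
    let e₀ : {p // K p < j} ≃ Fin (m j) := (Equiv.ofBijective r hr).symm
    have he₀ (p : {p // K p < j}) : ρ j (e₀ p) = p.1 :=
      congrArg Subtype.val ((Equiv.ofBijective r hr).apply_symm_apply p)
    have hlab (p : Fin n) (hp : K p < j) : labelling (y ∘ ρ j) e₀ p = y p := by
      simp [labelling, hp, he₀]
    rw [chainSum, Finset.sum_eq_single e₀, levelFactor_congr hlab (fun _ _ => rfl),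
      chainSum_congr hlab, ih, Finset.prod_range_succ, mul_comm]
    · intro e _ he
      by_contra hne
      refine he (Equiv.ext fun p => hρ j ?_)
      rw [he₀, eq_of_levelFactor_ne_zero hρ (hrange j) le_rfl (fun _ => Iff.rfl) e
        (left_ne_zero_of_mul hne)]
    · simp

end Triangular

/-! ### Weight functions at `z_I`: exchange, vanishing and diagonal values. -/

section Orthogonality

variable {N n : ℕ} {lam : Fin N → ℕ}

theorem blockIndex_permInv (σ : Equiv.Perm (Fin n)) (I : Partitions n lam) :
    blockIndex (permInv σ I) = blockIndex I ∘ σ := rfl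

theorem blockIndex_injective : Function.Injective (blockIndex (n := n) (lam := lam)) :=
  fun _ _ h => Subtype.ext (funext fun p => Fin.ext (congrFun h p))

theorem blockIndex_lt_top (I : Partitions n lam) (p : Fin n) : blockIndex I p < N := (I.1 p).2

theorem permInv_permInv (σ τ : Equiv.Perm (Fin n)) (I : Partitions n lam) :
    permInv τ (permInv σ I) = permInv (σ * τ) I := rfl

theorem permInv_one (I : Partitions n lam) : permInv 1 I = I := rfl

theorem mem_blockUnion (I : Partitions n lam) (j : ℕ) (p : Fin n) :
    p ∈ blockUnion I j ↔ blockIndex I p < j := by simp [blockUnion, blockIndex]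

theorem card_filter_blockIndex (I : Partitions n lam) (j : ℕ) :
    #{p | blockIndex I p < j} = partialSum lam j := card_blockUnion I j

theorem sum_val_le_sum_val {A B : Finset (Fin n)} (hcard : #A = #B)
    (hle : ∀ p ∈ A, p ∉ B → ∀ q ∈ B, q ∉ A → p ≤ q) : ∑ p ∈ A, p.val ≤ ∑ p ∈ B, p.val := by
  rw [← Finset.sum_inter_add_sum_sdiff A B, ← Finset.sum_inter_add_sum_sdiff B A,
    Finset.inter_comm B A]
  refine Nat.add_le_add_left ?_ _
  have hc : #(A \ B) = #(B \ A) := Finset.card_sdiff_comm hcard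
  rcases (B \ A).eq_empty_or_nonempty with h0 | h0
  · rw [h0, card_empty, card_eq_zero] at hc
    rw [hc, h0]
  · set q := (B \ A).min' h0
    have hq := (B \ A).min'_mem h0
    calc ∑ p ∈ A \ B, p.val ≤ #(A \ B) • q.val := Finset.sum_le_card_nsmul _ _ _ fun p hp => by
          rw [mem_sdiff] at hp hq
          exact hle p hp.1 hp.2 q hq.1 hq.2
      _ ≤ ∑ p ∈ B \ A, p.val := by
          rw [hc]
          exact Finset.card_nsmul_le_sum _ _ _ fun p hp => (B \ A).min'_le p hp

/-- The value of the weight function of `J` in the variables `y` at `t = z_I`. -/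
def weightAt (J I : Partitions n lam) (y : Fin n → RatZH n) : RatZH n :=
  W J (fun j a => zvar (enum I j a)) y hvar

theorem weightAt_eq_chainSum (J I : Partitions n lam) (y : Fin n → RatZH n) :
    weightAt J I y = (-hvar) ^ (∑ j ∈ Ico 1 N, partialSum lam j) *
      chainSum hvar (fun j => zvar ∘ enum I j) (blockIndex J) N y :=
  W_eq_chainSum J (fun j => zvar ∘ enum I j) y hvar

theorem weightAt_exchange {a b : Fin n} (hab : a < b)
    (hadj : ∀ p, p ≠ a → p ≠ b → (p < a ↔ p < b)) (J I : Partitions n lam) (y : Fin n → RatZH n) :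
    (y a - y b + hvar) * weightAt J I (y ∘ Equiv.swap a b) =
      hvar * weightAt J I y + (y a - y b) * weightAt (permInv (Equiv.swap a b) J) I y := by
  have := chainSum_exchange (h := hvar) (y := y) hab hadj (t := fun j => zvar ∘ enum I j)
    (fun j => zvar_injective.comp (enum I j).injective)
    (blockIndex_lt_top J a) (blockIndex_lt_top J b)
  simp only [weightAt_eq_chainSum, blockIndex_permInv]
  linear_combination (-hvar) ^ (∑ j ∈ Ico 1 N, partialSum lam j) * this

/-- Puts the substituted values in the form `y ∘ ρ j` with `y = zvar ∘ σ`, as triangularity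
requires. -/
theorem chainSum_enum_eq (J I : Partitions n lam) (σ : Equiv.Perm (Fin n)) :
    chainSum hvar (fun j => zvar ∘ enum I j) (blockIndex J) N (zvar ∘ σ) =
      chainSum hvar (fun j => (zvar ∘ σ) ∘ (σ.symm ∘ enum I j)) (blockIndex J) N (zvar ∘ σ) := by
  congr 1
  ext j a
  simp

theorem range_enum_symm (I : Partitions n lam) (σ : Equiv.Perm (Fin n)) (j : ℕ) (q : Fin n) :
    blockIndex (permInv σ I) q < j ↔ q ∈ Set.range (σ.symm ∘ enum I j) := by
  rw [blockIndex_permInv, Function.comp_apply, ← mem_blockUnion, Set.range_comp, enum,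
    Finset.range_orderEmbOfFin]
  exact ⟨fun h => ⟨σ q, h, by simp⟩, by rintro ⟨p, hp, rfl⟩; simpa using hp⟩

theorem enum_symm_injective (I : Partitions n lam) (σ : Equiv.Perm (Fin n)) (j : ℕ) :
    Function.Injective (σ.symm ∘ enum I j) := σ.symm.injective.comp (enum I j).injective

/-- `hle` says that, at each level, the positions only in `J` precede those only in `σ⁻¹(I)`. This
gives the comparison of position sums under which triangularity applies. -/
theorem eq_permInv_of_weightAt_ne_zero {J I : Partitions n lam} {σ : Equiv.Perm (Fin n)}
    (hle : ∀ p q, ∀ j, blockIndex J p < j → j ≤ blockIndex (permInv σ I) p →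
      blockIndex (permInv σ I) q < j → j ≤ blockIndex J q → p ≤ q)
    (hne : weightAt J I (zvar ∘ σ) ≠ 0) : J = permInv σ I := by
  rw [weightAt_eq_chainSum, chainSum_enum_eq] at hne
  have hsum (j : ℕ) : ∑ p with blockIndex J p < j, p.val ≤
      ∑ p with blockIndex (permInv σ I) p < j, p.val := by
    refine sum_val_le_sum_val (by rw [card_filter_blockIndex, card_filter_blockIndex]) ?_
    intro p hp hp' q hq hq'
    simp only [mem_filter, mem_univ, true_and, not_lt] at hp hp' hq hq'
    exact hle p q j hp hp' hq hq'
  have h (i : ℕ) (hi : i ≤ N) :=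
    lt_iff_of_chainSum_ne_zero (enum_symm_injective I σ) (range_enum_symm I σ) hsum
      (fun p => by simp only [blockIndex_lt_top]) (right_ne_zero_of_mul hne) hi
  apply blockIndex_injective
  funext p
  have h1 := blockIndex_lt_top J p
  have h2 := blockIndex_lt_top (permInv σ I) p
  have h3 := h (blockIndex J p + 1) (by lia) p
  have h4 := h (blockIndex (permInv σ I) p + 1) (by lia) p
  lia

theorem weightAt_permInv (I : Partitions n lam) (σ : Equiv.Perm (Fin n)) :
    weightAt (permInv σ I) I (zvar ∘ σ) = (-hvar) ^ (∑ j ∈ Ico 1 N, partialSum lam j) *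
      ∏ j ∈ range N, levelFactor hvar j (blockIndex (permInv σ I)) (zvar ∘ σ) (zvar ∘ σ) := by
  rw [weightAt_eq_chainSum, chainSum_enum_eq,
    chainSum_eq_prod (enum_symm_injective I σ) (range_enum_symm I σ)]

/-! ### The diagonal value as a product over ordered pairs. -/

section Diagonal

variable {F : Type*} [Field F]

theorem pow_partialSum (J : Partitions n lam) (h : F) :
    (-h) ^ (∑ j ∈ Ico 1 N, partialSum lam j) =
      ∏ j ∈ Ico 1 N, ∏ x : Fin n × Fin n,
        if x.1 = x.2 ∧ blockIndex J x.1 < j then -h else 1 := by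
  rw [← Finset.prod_pow_eq_pow_sum]
  refine Finset.prod_congr rfl fun j _ => ?_
  rw [Fintype.prod_prod_type]
  simp only [ite_and, Finset.prod_ite_eq, mem_univ, if_true]
  rw [← Finset.prod_filter, Finset.prod_const, card_filter_blockIndex]

theorem levelFactor_comp_rev {h : F} {j : ℕ} {J : Fin n → ℕ} {y : Fin n → F} :
    levelFactor h j (J ∘ Fin.revPerm) (y ∘ Fin.revPerm) (y ∘ Fin.revPerm) =
      ∏ x : Fin n × Fin n,
        (crossFactor h j (cmp x.2 x.1) (J x.1) (J x.2) (y x.1) (y x.2) *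
          selfFactor h j (cmp x.2 x.1) (J x.1) (J x.2) (y x.1) (y x.2)) := by
  unfold levelFactor
  rw [← Equiv.prod_comp (Fin.revPerm.prodCongr Fin.revPerm)]
  refine Finset.prod_congr rfl fun x _ => ?_
  have hc : cmp x.1.rev x.2.rev = cmp x.2 x.1 := by
    simp only [cmp, cmpUsing, Fin.rev_lt_rev]
  simp [pairFactor, hc]

/-- Between the two orders, a pair `p ≠ q` receives both cross factors `y p - y q` and `y p - y q -
h`, and the self factor exactly once. Inside the level the self factor turns this into `(y p - y q -
h) ^ 2`, a factor of `c ^ 2`; for `q` in the next block the cross factors remain and give `R * Q`.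
The powers of `-h` supply the pairs `p = q` of `c ^ 2`. -/
theorem levelFactor_mul_rev {h : F} {j : ℕ} {J : Fin n → ℕ} {y : Fin n → F}
    (hy : Function.Injective y) :
    (∏ x : Fin n × Fin n, if x.1 = x.2 ∧ J x.1 < j then -h else 1) ^ 2 *
      (levelFactor h j J y y *
        levelFactor h j (J ∘ Fin.revPerm) (y ∘ Fin.revPerm) (y ∘ Fin.revPerm)) =
    ∏ x : Fin n × Fin n,
      ((if J x.1 < j ∧ J x.2 < j then y x.1 - y x.2 - h else 1) ^ 2 *
        if J x.1 < j ∧ J x.2 = j then (y x.1 - y x.2) * (y x.1 - y x.2 - h) else 1) := by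
  rw [levelFactor_comp_rev]
  unfold levelFactor
  rw [← Finset.prod_pow, ← Finset.prod_mul_distrib, ← Finset.prod_mul_distrib]
  refine Finset.prod_congr rfl ?_
  rintro ⟨p, q⟩ -
  by_cases hp : J p < j
  swap
  · simp [pairFactor, crossFactor, selfFactor, hp]
  rcases eq_or_ne p q with rfl | hpq
  · simp [pairFactor, crossFactor, selfFactor, hp, hp.ne]
  have hne : y p - y q ≠ 0 := sub_ne_zero.2 (hy.ne hpq)
  rcases hpq.lt_or_gt with hlt | hlt
  all_goals
    have hc1 := (cmp_eq_lt_iff _ _).2 hlt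
    have hc2 := (cmp_eq_gt_iff _ _).2 hlt
    simp only [pairFactor, crossFactor, selfFactor, hc1, hc2, hp, hpq, true_and,
      if_false, and_true, reduceCtorEq, and_false, mul_one]
    rcases lt_trichotomy (J q) j with hq | hq | hq
    · have hq' : J q < j + 1 := by lia
      simp only [hq, hq', hq.ne, if_true, if_false]
      field_simp
    · have hq' : J q < j + 1 := by lia
      simp [hq, mul_comm]
    · have hq' : ¬ J q < j + 1 := by lia
      simp [hq', hq.not_gt, hq.ne']

theorem prod_lt_and_eq (J : Partitions n lam) (p q : Fin n) (f : F) :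
    ∏ j ∈ Ico 1 N, (if blockIndex J p < j ∧ blockIndex J q = j then f else 1) =
      if blockIndex J p < blockIndex J q then f else 1 := by
  split_ifs with hpq
  · rw [Finset.prod_eq_single (blockIndex J q)]
    · simp [hpq]
    · intro j _ hj
      simp [hj.symm]
    · intro hq
      have := blockIndex_lt_top J q
      simp only [mem_Ico] at hq
      lia
  · refine Finset.prod_eq_one fun j _ => if_neg ?_
    lia

theorem prod_levelFactor_mul_rev (J : Partitions n lam) {h : F} {y : Fin n → F}
    (hy : Function.Injective y) :
    ((-h) ^ (∑ j ∈ Ico 1 N, partialSum lam j)) ^ 2 *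
      ((∏ j ∈ range N, levelFactor h j (blockIndex J) y y) *
        ∏ j ∈ range N, levelFactor h j (blockIndex J ∘ Fin.revPerm) (y ∘ Fin.revPerm)
          (y ∘ Fin.revPerm)) =
    (∏ x : Fin n × Fin n, if blockIndex J x.1 < blockIndex J x.2 then
        (y x.1 - y x.2) * (y x.1 - y x.2 - h) else 1) *
      (∏ j ∈ Ico 1 N, ∏ x : Fin n × Fin n,
        if blockIndex J x.1 < j ∧ blockIndex J x.2 < j then y x.1 - y x.2 - h else 1) ^ 2 := by
  have hrange (g : Fin n → ℕ) (u : Fin n → F) :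
      ∏ j ∈ range N, levelFactor h j g u u = ∏ j ∈ Ico 1 N, levelFactor h j g u u := by
    symm
    refine Finset.prod_subset (fun j hj => by simp only [mem_Ico, mem_range] at hj ⊢; lia) ?_
    intro j hj hj'
    -- Level `0` is empty and contributes `1`, which reconciles `range N` with `Ico 1 N`.
    obtain rfl : j = 0 := by simp only [mem_Ico, mem_range] at hj hj'; lia
    simp [levelFactor, pairFactor, crossFactor, selfFactor]
  rw [hrange, hrange, pow_partialSum J, ← Finset.prod_mul_distrib, ← Finset.prod_pow,
    ← Finset.prod_mul_distrib]
  simp only [levelFactor_mul_rev hy, ← prod_lt_and_eq]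
  conv_rhs => rw [Finset.prod_comm, ← Finset.prod_pow, ← Finset.prod_mul_distrib]
  refine Finset.prod_congr rfl fun j _ => ?_
  rw [← Finset.prod_pow, ← Finset.prod_mul_distrib]
  exact Finset.prod_congr rfl fun x _ => mul_comm _ _

theorem prod_block_prod_block (I : Partitions n lam) (f : Fin n → Fin n → F) :
    ∏ a : Fin N, ∏ b with a < b, ∏ i ∈ block I a, ∏ j ∈ block I b, f i j =
      ∏ x : Fin n × Fin n, if blockIndex I x.1 < blockIndex I x.2 then f x.1 x.2 else 1 := by
  rw [Fintype.prod_prod_type]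
  refine Eq.trans ?_ (Finset.prod_fiberwise univ I.1 _)
  refine Finset.prod_congr rfl fun a _ => ?_
  refine Eq.trans ?_ (Finset.prod_congr rfl fun p _ => Finset.prod_fiberwise univ I.1
    (fun q => if blockIndex I p < blockIndex I q then f p q else 1))
  rw [Finset.prod_filter]
  conv_rhs => rw [Finset.prod_comm]
  refine Finset.prod_congr rfl fun b _ => ?_
  by_cases hab : a < b
  · rw [if_pos hab]
    refine Finset.prod_congr rfl fun i hi => Finset.prod_congr rfl fun j hj => ?_
    simp only [mem_filter, mem_univ, true_and] at hi hj
    rw [if_pos]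
    simpa [blockIndex, hi, hj] using hab
  · rw [if_neg hab]
    refine (Finset.prod_eq_one fun i hi => Finset.prod_eq_one fun j hj => ?_).symm
    simp only [mem_filter, mem_univ, true_and] at hi hj
    rw [if_neg]
    simpa [blockIndex, hi, hj] using hab

end Diagonal

theorem R_mul_Q_mul_c (I : Partitions n lam) (σ : Equiv.Perm (Fin n)) :
    R I * Q I * c I ^ 2 =
    (∏ x : Fin n × Fin n, if blockIndex I (σ x.1) < blockIndex I (σ x.2) then
        (zvar (σ x.1) - zvar (σ x.2)) * (zvar (σ x.1) - zvar (σ x.2) - hvar) else 1) *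
      (∏ j ∈ Ico 1 N, ∏ x : Fin n × Fin n,
        if blockIndex I (σ x.1) < j ∧ blockIndex I (σ x.2) < j then
          zvar (σ x.1) - zvar (σ x.2) - hvar else 1) ^ 2 := by
  have hσ (f : Fin n × Fin n → RatZH n) : ∏ x : Fin n × Fin n, f (σ x.1, σ x.2) = ∏ x, f x :=
    Equiv.prod_comp (σ.prodCongr σ) f
  unfold R Q c
  rw [prod_block_prod_block, prod_block_prod_block, ← Finset.prod_mul_distrib]
  congr 1
  · rw [← hσ]
    refine Finset.prod_congr rfl fun x _ => ?_
    split_ifs <;> simp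
  · congr 1
    refine Finset.prod_congr rfl fun j _ => ?_
    refine Eq.trans ?_ (hσ (fun x => if blockIndex I x.1 < j ∧ blockIndex I x.2 < j then
      zvar x.1 - zvar x.2 - hvar else 1)).symm
    rw [Fintype.prod_prod_type]
    have (s : Finset (Fin n)) (f : Fin n → RatZH n) :
      ∏ p ∈ s, f p = ∏ p, if p ∈ s then f p else 1 := by simp
    rw [this]
    refine Finset.prod_congr rfl fun p _ => ?_
    simp only [mem_blockUnion]
    by_cases hp : blockIndex I p < j
    · simp only [hp, if_true, true_and]
      rw [this]
      simp only [mem_blockUnion]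
    · simp [hp]

theorem algebraMap_ne_zero_of_eval {q : MvPolynomial (ZHVar n) ℂ} (f : ZHVar n → ℂ)
    (hq : MvPolynomial.eval f q ≠ 0) : algebraMap _ (RatZH n) q ≠ 0 := by
  refine (map_ne_zero_iff _ (IsFractionRing.injective _ _)).2 ?_
  rintro rfl
  simp at hq

theorem zvar_sub_zvar_sub_hvar_ne_zero (p q : Fin n) : zvar p - zvar q - hvar ≠ 0 := by
  unfold zvar hvar
  rw [← map_sub, ← map_sub]
  -- At `z = 0`, `h = 1` the polynomial takes the value `-1`.
  refine algebraMap_ne_zero_of_eval (fun v => match v with | .z _ => 0 | .h => 1) ?_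
  simp

theorem R_mul_Q_mul_c_ne_zero (I : Partitions n lam) : R I * Q I * c I ^ 2 ≠ 0 := by
  rw [R_mul_Q_mul_c I 1]
  refine mul_ne_zero (Finset.prod_ne_zero_iff.2 fun x _ => ?_)
    (pow_ne_zero _ (Finset.prod_ne_zero_iff.2 fun j _ => Finset.prod_ne_zero_iff.2 fun x _ => ?_))
  · split_ifs with hx
    · refine mul_ne_zero (sub_ne_zero.2 (zvar_injective.ne ?_)) (zvar_sub_zvar_sub_hvar_ne_zero _ _)
      rintro heq
      rw [Equiv.Perm.one_apply, Equiv.Perm.one_apply] at heq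
      rw [heq] at hx
      exact lt_irrefl _ hx
    · exact one_ne_zero
  · split_ifs
    · exact zvar_sub_zvar_sub_hvar_ne_zero _ _
    · exact one_ne_zero

/-! ### Orthogonality by induction along adjacent transpositions. -/

/-- The pairing of the weight functions for the orderings `σ` and `σ σ₀`. -/
def pairing (σ : Equiv.Perm (Fin n)) (J K : Partitions n lam) : RatZH n :=
  ∑ I : Partitions n lam, weightAt J I (zvar ∘ σ) *
    weightAt (permInv Fin.revPerm K) I (zvar ∘ (σ * Fin.revPerm : Equiv.Perm (Fin n))) /
      (R I * Q I * c I ^ 2)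

theorem pairing_of_monotone (σ : Equiv.Perm (Fin n)) {J : Partitions n lam} (hJ : Monotone J.1)
    (K : Partitions n lam) : pairing σ J K = if J = K then 1 else 0 := by
  have hmono {p q : Fin n} (h : blockIndex J p < blockIndex J q) : p < q := by
    by_contra! hqp
    exact h.not_ge (hJ hqp)
  obtain ⟨I₀, rfl⟩ : ∃ I₀, J = permInv σ I₀ := ⟨permInv σ⁻¹ J, by
    rw [permInv_permInv, inv_mul_cancel, permInv_one]⟩
  unfold pairing
  rw [Finset.sum_eq_single I₀]
  · have hrev : permInv Fin.revPerm (permInv σ I₀) = permInv (σ * Fin.revPerm) I₀ := rfl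
    split_ifs with hK
    · subst hK
      rw [div_eq_one_iff_eq (R_mul_Q_mul_c_ne_zero I₀), hrev, weightAt_permInv, weightAt_permInv,
        R_mul_Q_mul_c I₀ σ]
      have := prod_levelFactor_mul_rev (permInv σ I₀) (h := hvar)
        (zvar_injective.comp σ.injective)
      refine Eq.trans ?_ this
      simp only [← hrev, blockIndex_permInv]
      have e : (zvar ∘ (σ * Fin.revPerm : Equiv.Perm (Fin n)) : Fin n → RatZH n) =
        (zvar ∘ σ) ∘ Fin.revPerm := rfl
      rw [e]
      ring
    · rw [div_eq_zero_iff, mul_eq_zero]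
      refine Or.inl (Or.inr ?_)
      by_contra hne
      refine hK ?_
      have h := eq_permInv_of_weightAt_ne_zero ?_ hne
      · rw [← hrev] at h
        have h' := congrArg (permInv Fin.revPerm) h
        have hr : (Fin.revPerm * Fin.revPerm : Equiv.Perm (Fin n)) = 1 := by ext; simp
        rw [permInv_permInv, permInv_permInv, hr, permInv_one, permInv_one] at h'
        exact h'.symm
      -- Reversal turns the initial segments of the monotone `J` into final segments, which have the
      -- largest position sums; this is why triangularity now applies with the roles exchanged.
      · intro p q j h1 h2 h3 h4
        rw [← hrev, blockIndex_permInv, Function.comp_apply] at h2 h3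
        have := hmono (h3.trans_le h2)
        simpa using this.le
  · intro I _ hI
    have : weightAt (permInv σ I₀) I (zvar ∘ σ) = 0 := by
      by_contra hne
      have h := eq_permInv_of_weightAt_ne_zero ?_ hne
      · have h' := congrArg (permInv σ⁻¹) h
        rw [permInv_permInv, permInv_permInv, mul_inv_cancel, permInv_one, permInv_one] at h'
        exact hI h'.symm
      · intro p q j h1 h2 h3 h4
        exact (hmono (h1.trans_le h4)).le
    simp [this]
  · simp

theorem pairing_permInv_swap {a b : Fin n} (hab : a < b)
    (hadj : ∀ p, p ≠ a → p ≠ b → (p < a ↔ p < b)) {J : Partitions n lam}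
    (hJ : ∀ σ K, pairing σ J K = if J = K then 1 else 0) (σ : Equiv.Perm (Fin n))
    (K : Partitions n lam) : pairing σ (permInv (Equiv.swap a b) J) K =
      if permInv (Equiv.swap a b) J = K then 1 else 0 := by
  set s := Equiv.swap a b with hs
  set x : RatZH n := zvar (σ a) - zvar (σ b) with hx
  have hx0 : x ≠ 0 := sub_ne_zero.2 ((zvar_injective.comp σ.injective).ne hab.ne)
  have hss : s * s = 1 := Equiv.swap_mul_self a b
  have hrevs : Fin.revPerm * Equiv.swap b.rev a.rev = s * Fin.revPerm := by
    have := Equiv.mul_swap_eq_swap_mul (Fin.revPerm (n := n)) b.rev a.rev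
    rw [this]
    simp [hs, Equiv.swap_comm]
  have h1 (I : Partitions n lam) :
      (x + hvar) * weightAt J I (zvar ∘ (σ * s : Equiv.Perm (Fin n))) =
      hvar * weightAt J I (zvar ∘ σ) + x * weightAt (permInv s J) I (zvar ∘ σ) :=
    weightAt_exchange hab hadj J I (zvar ∘ σ)
  have h2 (I : Partitions n lam) :
      (x + hvar) * weightAt (permInv Fin.revPerm K) I
        (zvar ∘ (σ * Fin.revPerm : Equiv.Perm (Fin n))) =
      hvar * weightAt (permInv Fin.revPerm K) I
        (zvar ∘ (σ * s * Fin.revPerm : Equiv.Perm (Fin n))) +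
      x * weightAt (permInv Fin.revPerm (permInv s K)) I
        (zvar ∘ (σ * s * Fin.revPerm : Equiv.Perm (Fin n))) := by
    have hadj' (p : Fin n) (h1 : p ≠ b.rev) (h2 : p ≠ a.rev) : p < b.rev ↔ p < a.rev := by
      have h := hadj p.rev (by rintro rfl; simp at h2) (by rintro rfl; simp at h1)
      have h3 : p.rev ≠ a := by rintro rfl; simp at h2
      have h4 : p.rev ≠ b := by rintro rfl; simp at h1
      have e (c : Fin n) : p < c.rev ↔ c < p.rev := Fin.lt_rev_iff
      rw [e, e, ← not_iff_not, not_lt, not_lt, h4.le_iff_lt, h3.le_iff_lt, h]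
    -- In the reversed order the pair to exchange is `b.rev < a.rev`. Starting from the ordering `σ
    -- * s * Fin.revPerm` makes the difference of the two variables equal to the same `x` as in
    -- `h1`.
    have := weightAt_exchange (Fin.rev_lt_rev.2 hab) hadj' (permInv Fin.revPerm K) I
      (zvar ∘ (σ * s * Fin.revPerm : Equiv.Perm (Fin n)))
    have e1 : (zvar ∘ (σ * s * Fin.revPerm : Equiv.Perm (Fin n))) ∘ Equiv.swap b.rev a.rev =
        (zvar ∘ (σ * Fin.revPerm : Equiv.Perm (Fin n)) : Fin n → RatZH n) := by
      have : σ * s * Fin.revPerm * Equiv.swap b.rev a.rev = σ * Fin.revPerm := by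
        rw [mul_assoc, hrevs, ← mul_assoc, mul_assoc σ, hss, mul_one]
      rw [← this]
      rfl
    rw [e1, permInv_permInv, hrevs, ← permInv_permInv] at this
    simpa [hs] using this
  -- `h1` trades `s(J)` for `J`, and `h2` then absorbs the resulting factor `x + h`. The two terms
  -- with `hvar` cancel because `hJ` holds for every `σ`.
  have key : x * pairing σ (permInv s J) K = hvar * pairing (σ * s) J K +
      x * pairing (σ * s) J (permInv s K) - hvar * pairing σ J K := by
    unfold pairing
    rw [Finset.mul_sum, Finset.mul_sum, Finset.mul_sum, Finset.mul_sum, ← Finset.sum_add_distrib,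
      ← Finset.sum_sub_distrib]
    refine Finset.sum_congr rfl fun I _ => ?_
    simp only [div_eq_mul_inv]
    linear_combination (R I * Q I * c I ^ 2)⁻¹ *
      (weightAt J I (zvar ∘ (σ * s : Equiv.Perm (Fin n))) * h2 I -
        weightAt (permInv Fin.revPerm K) I (zvar ∘ (σ * Fin.revPerm : Equiv.Perm (Fin n))) * h1 I)
  rw [hJ, hJ, hJ, add_sub_right_comm, sub_self, zero_add] at key
  rw [mul_left_cancel₀ hx0 key]
  refine if_congr ⟨?_, ?_⟩ rfl rfl
  · rintro rfl
    rw [permInv_permInv, hss, permInv_one]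
  · rintro rfl
    rw [permInv_permInv, hss, permInv_one]

theorem pairing_eq (σ : Equiv.Perm (Fin n)) (J K : Partitions n lam) :
    pairing σ J K = if J = K then 1 else 0 := by
  cases n with
  | zero => exact pairing_of_monotone σ (fun p => p.elim0) K
  | succ n =>
    have hperm (τ : Equiv.Perm (Fin (n + 1))) : ∀ J : Partitions (n + 1) lam,
        (∀ σ K, pairing σ J K = if J = K then 1 else 0) →
        ∀ σ K, pairing σ (permInv τ J) K = if permInv τ J = K then 1 else 0 := by
      have hτ : τ ∈ Submonoid.closure
          (Set.range fun i : Fin n => Equiv.swap i.castSucc i.succ) := by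
        rw [Equiv.Perm.mclosure_swap_castSucc_succ]
        trivial
      induction hτ using Submonoid.closure_induction with
      | mem τ hτ =>
        obtain ⟨i, rfl⟩ := hτ
        intro J hJ
        refine pairing_permInv_swap Fin.castSucc_lt_succ (fun p h1 h2 => ?_) hJ
        simp only [ne_eq, Fin.ext_iff, Fin.lt_def, Fin.val_castSucc, Fin.val_succ] at h1 h2 ⊢
        lia
      | one => exact fun J hJ => hJ
      | mul τ τ' _ _ h1 h2 =>
        intro J hJ
        rw [← permInv_permInv]
        exact h2 _ (h1 _ hJ)
    -- Sorting `J` gives a monotone partition, and the inverse permutation leads back to `J`.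
    have := hperm (Tuple.sort J.1)⁻¹ (permInv (Tuple.sort J.1) J)
      (fun σ K => pairing_of_monotone σ (Tuple.monotone_sort J.1) K) σ K
    rwa [permInv_permInv, mul_inv_cancel, permInv_one] at this

end Orthogonality

end WeightFn

end

theorem lemma3p6 {N n : ℕ} (lam : Fin N → ℕ) (hlam : ∑ k, lam k = n)
    (J K : WeightFn.Partitions n lam) :
    ∑ I : WeightFn.Partitions n lam,
        WeightFn.subst I (WeightFn.weightFunction 1 J) *
            WeightFn.subst I (WeightFn.weightFunction Fin.revPerm K) /
          (WeightFn.R I * WeightFn.Q I * WeightFn.c I ^ 2) =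
      if J = K then 1 else 0 := by
  simp only [WeightFn.subst_weightFunction]
  exact WeightFn.pairing_eq 1 J K
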